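/- Let $\mathbb{F}_q$ be a finite field with $q$ elements, $A=\mathbb{F}_q[T]$, $k=\mathbb{F}_q(T)$, and let $\bar k$ be an algebraic closure of $k$. Let $C$ be the Carlitz module, i.e. the $\mathbb{F}_q$-algebra homomorphism $m\mapsto C_m$ from $A$ to the ring of $\mathbb{F}_q$-linear polynomials (under composition) determined by $C_T(x)=Tx+x^q$; thus $C_m(x)\in A[x]$ for $m \in A$. Let $P\in A$ be a monic prime, let $\Lambda_P=\{\lambda\in\bar k : C_P(\lambda)=0\}$, regarded as an $A$-module via $a\cdot\lambda=C_a(\lambda)$, let $\lambda_P$ be a generator of the $A$-module $\Lambda_P$, let $K_P=k(\Lambda_P)$ be the $P$-th cyclotomic function field, and let $\mathcal{O}_P$ be the ring of integers of $K_P$, i.e. the integral closure of $A$ in $K_P$. Let $\alpha\in\mathbb{F}_q^{\times}$ and let $M_P=\alpha C_P(1)\in A$. Then $M_P$ is a prime in $A$ if and only if $1-\lambda_P$ is a prime element of $\mathcal{O}_P$. Furthermore, when $M_P$ is a prime, $M_P$ splits completely in $K_P$, i.e. $M_P\mathcal{O}_P$ is a product of $[K_P:k]$ pairwise distinct nonzero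 prime ideals of $\mathcal{O}_P$. -/

import Mathlib

open Polynomial

noncomputable section

namespace Carlitz

variable (F : Type*) [Field F] [Fintype F]

/-- The `𝔽_q`-linear operator `f ↦ T f + f ^ q` on `A[x]`, where `A = 𝔽_q[T]`, `F = 𝔽_q`. -/
def operatorT : Module.End F F[X][X] where
  toFun f := C X * f + f ^ Fintype.card F
  map_add' f g := by
    rw [← FiniteField.frobeniusAlgHom_apply F, ← FiniteField.frobeniusAlgHom_apply F,
      ← FiniteField.frobeniusAlgHom_apply F, map_add]
    ring
  map_smul' c f := by
    rw [← FiniteField.frobeniusAlgHom_apply F, ← FiniteField.frobeniusAlgHom_apply F, map_smul,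
      RingHom.id_apply, smul_add, mul_smul_comm]

variable {F}

/-- The Carlitz polynomial `C_m(x) ∈ A[x]`: the result of letting `m ∈ A` act on the variable `x`
through the Carlitz module, i.e. the ring homomorphism `A → End(A[x])` which is `𝔽_q`-linear and
sends `T` to `T + τ`, where `τ(f) = f ^ q`. -/
def poly (m : F[X]) : F[X][X] := aeval (operatorT F) m X

theorem poly_C (c : F) : poly (C c) = C (C c) * X := by
  simp [poly, Algebra.smul_def]

theorem poly_X : poly (X : F[X]) = C X * X + X ^ Fintype.card F := by
  simp [poly, operatorT]

theorem poly_add (m n : F[X]) : poly (m + n) = poly m + poly n := by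
  simp [poly]

theorem poly_X_mul (m : F[X]) : poly (X * m) = C X * poly m + poly m ^ Fintype.card F := by
  simp [poly, operatorT]

/-- `Λ_m`, the set of roots of `C_m` in the algebraic closure `kbar` of `k = 𝔽_q(T)`. -/
def torsion (kbar : Type*) [Field kbar] [Algebra F[X] kbar] (m : F[X]) : Set kbar :=
  {μ | aeval μ (poly m) = 0}

/-- `l` is a root of `C_m` that generates the `A`-module `Λ_m`, on which `a ∈ A` acts as
`μ ↦ C_a(μ)`. -/
def IsPrimitiveTorsion {kbar : Type*} [Field kbar] [Algebra F[X] kbar] (m : F[X]) (l : kbar) :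
    Prop :=
  l ∈ torsion kbar m ∧ ∀ μ ∈ torsion kbar m, ∃ a : F[X], μ = aeval l (poly a)

/-- The cyclotomic function field `K_m = k(Λ_m)`, where `k = 𝔽_q(T)`. -/
abbrev cyclotomicField (kbar : Type*) [Field kbar] [Algebra F[X] kbar] [Algebra (RatFunc F) kbar]
    (m : F[X]) : IntermediateField (RatFunc F) kbar :=
  IntermediateField.adjoin (RatFunc F) (torsion kbar m)

/-- The prime `p` of `A` splits completely in the extension `K` of `k` with ring of integers `O`
(the integral closure of `A` in `K`): the ideal `p O` is a product of `[K : k]` pairwise distinct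
nonzero prime ideals of `O`. -/
def SplitsCompletely (K : Type*) [Field K] [Algebra F[X] K] [Algebra (RatFunc F) K] (p : F[X]) :
    Prop :=
  ∃ s : Finset (Ideal (FunctionField.ringOfIntegers F K)),
    (∀ 𝔮 ∈ s, 𝔮.IsPrime ∧ 𝔮 ≠ ⊥) ∧
    s.card = Module.finrank (RatFunc F) K ∧
    Ideal.span {algebraMap F[X] (FunctionField.ringOfIntegers F K) p} = ∏ 𝔮 ∈ s, 𝔮

end Carlitz

end

/-!
Let `q = |F|`, `n = q ^ deg P - 1`, `K = k(Λ_P)`, let `O` be the integral closure of `F[X]` in `K`,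
and let `λ` generate `Λ_P`.

The nonzero elements of `Λ_P` are the roots of `C_P(x) / x`, which has constant term `P`. They are
all of the form `C_a(λ)`, hence differ from each other by units of `O`, so `P` is a unit times
`λ ^ n`. Taking norms, `n` divides `[K : k]`; as `λ` generates `K` and is a root of a polynomial of
degree `n`, the degree is exactly `n` (`Carlitz.finrank_eq`). So the conjugates of `λ` are all the
nonzero elements of `Λ_P`, and `C_P(1)`, the value of `C_P(x) / x` at `1`, is the product of the
conjugates of `1 - λ`, i.e. its norm (`Carlitz.prod_one_sub`).

The second ingredient is that distinct conjugates `1 - σ λ` and `1 - τ λ` are coprime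
(`Carlitz.isCoprime_one_sub`): modulo both of them `1 ≡ τ λ = C_c(σ λ) ≡ C_c(1)`, so `C_{c - 1}` and
`C_P` kill `1`, and since `c - 1` and `P` are coprime this forces `1 ≡ 0`.

If `1 - λ` is prime and divides an element of `F[X]`, then so do its conjugates, and by coprimality
so does their product `C_P(1)`; hence `C_P(1)` is prime. Conversely, the relative norm of the ideal
`(1 - λ)` is `(C_P(1))`, and an ideal with prime norm is prime. In that case
`(C_P(1)) = ∏ σ, (1 - σ λ)` is a product of `[K : k]` prime ideals, distinct by coprimality.
-/

namespace Carlitz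

/-! ### Carlitz polynomials and the Carlitz action -/

section poly

variable {F : Type*} [Field F] [Fintype F]

omit [Fintype F] in
/-- Induction on `F[X]` matching the rules for computing `Carlitz.poly`: constants, addition and
multiplication by `X`. -/
theorem induction_X_mul {p : F[X] → Prop} (hC : ∀ c, p (C c)) (hadd : ∀ a b, p a → p b → p (a + b))
    (hX : ∀ a, p a → p (X * a)) (a : F[X]) : p a := by
  induction a using Polynomial.induction_on with
  | C c => exact hC c
  | add a b ha hb => exact hadd a b ha hb
  | monomial n c h =>
    rw [show C c * X ^ (n + 1) = X * (C c * X ^ n : F[X]) by ring]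
    exact hX _ h

@[simp]
theorem poly_one : poly (1 : F[X]) = X := by
  simpa using poly_C (1 : F)

theorem poly_neg (a : F[X]) : poly (-a) = -poly a := by
  simp [poly]

theorem coeff_zero_poly (a : F[X]) : (poly a).coeff 0 = 0 := by
  induction a using induction_X_mul with
  | hC c => simp [poly_C]
  | hadd a b ha hb => simp [poly_add, ha, hb]
  | hX a ha =>
    simp only [coeff_zero_eq_eval_zero] at ha ⊢
    simp [poly_X_mul, ha]

theorem derivative_poly (a : F[X]) : derivative (poly a) = C a := by
  induction a using induction_X_mul with
  | hC c => simp [poly_C]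
  | hadd a b ha hb => simp [poly_add, ha, hb]
  | hX a ha =>
    have h0 : (Fintype.card F : F[X]) = 0 := by
      rw [← map_natCast (C : F →+* F[X]), FiniteField.cast_card_eq_zero, map_zero]
    rw [poly_X_mul, derivative_add, derivative_C_mul, derivative_pow, ha, h0, C_0, C_mul]
    ring

theorem monic_poly_and_natDegree_poly (n : ℕ) (a : F[X]) (ha : a.Monic) (hn : a.natDegree = n) :
    (poly a).Monic ∧ (poly a).natDegree = Fintype.card F ^ n := by
  have hq : 1 < Fintype.card F := Fintype.one_lt_card
  induction n generalizing a with
  | zero =>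
    rw [ha.natDegree_eq_zero] at hn
    simp [hn, monic_X]
  | succ n ih =>
    have hb : (divX a).natDegree = n := by rw [natDegree_divX_eq_natDegree_tsub_one, hn]; rfl
    have hbm : (divX a).Monic := by
      rw [Monic, leadingCoeff, hb, coeff_divX, ← hn]
      exact ha
    obtain ⟨h1, h2⟩ := ih _ hbm hb
    have e : poly a = poly (divX a) ^ Fintype.card F +
        (C X * poly (divX a) + C (C (a.coeff 0)) * X) := by
      conv_lhs => rw [← X_mul_divX_add a, poly_add, poly_X_mul, poly_C]
      ring
    have hd : (poly (divX a) ^ Fintype.card F).natDegree = Fintype.card F ^ (n + 1) := by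
      rw [h1.natDegree_pow, h2, pow_succ']
    have hlt : (C X * poly (divX a) + C (C (a.coeff 0)) * X).degree <
        (poly (divX a) ^ Fintype.card F).degree := by
      apply degree_lt_degree
      rw [hd]
      have h3 : Fintype.card F ^ n < Fintype.card F ^ (n + 1) := Nat.pow_lt_pow_right hq n.lt_succ_self
      have h4 : 1 < Fintype.card F ^ (n + 1) := Nat.one_lt_pow n.succ_ne_zero hq
      refine (natDegree_add_le _ _).trans_lt (max_lt ?_ ?_)
      · exact (natDegree_C_mul_le _ _).trans_lt (h2 ▸ h3)
      · exact (natDegree_C_mul_le _ _).trans_lt (natDegree_X_le.trans_lt h4)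
    rw [e]
    refine ⟨(h1.pow _).add_of_left hlt, ?_⟩
    rw [natDegree_add_eq_left_of_degree_lt hlt, hd]

theorem monic_poly {a : F[X]} (ha : a.Monic) : (poly a).Monic :=
  (monic_poly_and_natDegree_poly _ a ha rfl).1

theorem natDegree_poly {a : F[X]} (ha : a.Monic) :
    (poly a).natDegree = Fintype.card F ^ a.natDegree :=
  (monic_poly_and_natDegree_poly _ a ha rfl).2

end poly

section action

variable {F : Type*} [Field F] [Fintype F] {R : Type*} [CommRing R] [Algebra F[X] R]

theorem aeval_poly_X_mul (a : F[X]) (r : R) :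
    aeval r (poly (X * a)) = algebraMap F[X] R X * aeval r (poly a) +
      aeval r (poly a) ^ Fintype.card F := by
  simp [poly_X_mul]

@[simp]
theorem aeval_zero_poly (a : F[X]) : aeval (0 : R) (poly a) = 0 := by
  rw [← coeff_zero_eq_aeval_zero', coeff_zero_poly, map_zero]

theorem aeval_add_poly (a : F[X]) (r s : R) :
    aeval (r + s) (poly a) = aeval r (poly a) + aeval s (poly a) := by
  let : Algebra F R := ((algebraMap F[X] R).comp C).toAlgebra
  induction a using induction_X_mul generalizing r s with
  | hC c => simp [poly_C, mul_add]
  | hadd a b ha hb => simp only [poly_add, map_add, ha, hb]; ring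
  | hX a ha =>
    have h : ∀ x y : R, (x + y) ^ Fintype.card F = x ^ Fintype.card F + y ^ Fintype.card F :=
      fun x y => map_add (FiniteField.frobeniusAlgHom F R) x y
    simp only [aeval_poly_X_mul, ha, h]
    ring

theorem aeval_poly_C_mul (c : F) (a : F[X]) (r : R) :
    aeval r (poly (C c * a)) = algebraMap F[X] R (C c) * aeval r (poly a) := by
  induction a using induction_X_mul with
  | hC d =>
    rw [← C_mul, poly_C, poly_C]
    simp [mul_assoc]
  | hadd a b ha hb => simp only [mul_add, poly_add, map_add, ha, hb]
  | hX a ha =>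
    rw [mul_left_comm, aeval_poly_X_mul, aeval_poly_X_mul, ha, mul_pow, ← map_pow, ← map_pow,
      FiniteField.pow_card]
    ring

/-- The Carlitz polynomials turn every `F[X]`-algebra into an `F[X]`-module, since
`C_{ab}(r) = C_a(C_b(r))`. -/
theorem aeval_poly_mul (a b : F[X]) (r : R) :
    aeval r (poly (a * b)) = aeval (aeval r (poly b)) (poly a) := by
  induction a using induction_X_mul with
  | hC c => simp [poly_C, aeval_poly_C_mul]
  | hadd a a' ha ha' => simp only [add_mul, poly_add, map_add, ha, ha']
  | hX a ha => rw [mul_assoc, aeval_poly_X_mul, ha, aeval_poly_X_mul]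

theorem aeval_poly_mul_eq_zero {a : F[X]} {r : R} (h : aeval r (poly a) = 0) (b : F[X]) :
    aeval r (poly (b * a)) = 0 := by
  rw [aeval_poly_mul, h, aeval_zero_poly]

theorem dvd_aeval_poly (a : F[X]) (r : R) : r ∣ aeval r (poly a) := by
  obtain ⟨Q, hQ⟩ := X_dvd_iff.2 (coeff_zero_poly a)
  exact ⟨aeval r Q, by rw [hQ, map_mul, aeval_X]⟩

theorem eq_zero_of_aeval_poly_eq_zero {a b : F[X]} (hab : IsCoprime a b) {r : R}
    (ha : aeval r (poly a) = 0) (hb : aeval r (poly b) = 0) : r = 0 := by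
  obtain ⟨u, v, huv⟩ := hab
  have h := aeval_X (R := F[X]) r
  rw [← poly_one, ← huv, poly_add, map_add, aeval_poly_mul_eq_zero ha, aeval_poly_mul_eq_zero hb,
    add_zero] at h
  exact h.symm

end action

/-! ### The torsion module of a prime -/

section cyclotomicPoly

variable {F : Type*} [Field F] [Fintype F]

/-- `C_a(x) / x`. For a prime `a = P` its roots are the generators of `Λ_P`, so it plays the role
of the cyclotomic polynomial. -/
noncomputable def cyclotomicPoly (a : F[X]) : F[X][X] := divX (poly a)

theorem X_mul_cyclotomicPoly (a : F[X]) : X * cyclotomicPoly a = poly a := by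
  simpa only [cyclotomicPoly, coeff_zero_poly, C_0, add_zero] using X_mul_divX_add (poly a)

theorem coeff_zero_cyclotomicPoly (a : F[X]) : (cyclotomicPoly a).coeff 0 = a := by
  simpa [cyclotomicPoly, coeff_derivative] using congrArg (coeff · 0) (derivative_poly a)

theorem eval_one_cyclotomicPoly (a : F[X]) : (cyclotomicPoly a).eval 1 = (poly a).eval 1 := by
  simp [← X_mul_cyclotomicPoly a]

theorem monic_cyclotomicPoly {a : F[X]} (ha : a.Monic) : (cyclotomicPoly a).Monic :=
  monic_X.of_mul_monic_left (X_mul_cyclotomicPoly a ▸ monic_poly ha)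

theorem natDegree_cyclotomicPoly {a : F[X]} (ha : a.Monic) :
    (cyclotomicPoly a).natDegree = Fintype.card F ^ a.natDegree - 1 := by
  rw [cyclotomicPoly, natDegree_divX_eq_natDegree_tsub_one, natDegree_poly ha]

theorem aeval_poly_eq_zero_of_cyclotomicPoly {R : Type*} [CommRing R] [Algebra F[X] R] {a : F[X]}
    {r : R} (h : aeval r (cyclotomicPoly a) = 0) : aeval r (poly a) = 0 := by
  rw [← X_mul_cyclotomicPoly, map_mul, h, mul_zero]

end cyclotomicPoly

section field

variable {F : Type*} [Field F] [Fintype F] {K : Type*} [Field K] [Algebra F[X] K]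
  {P : F[X]} {l : K}

/-- The generator of `Λ_P` is recovered from any nonzero element of `Λ_P`, because `F[X] / P` is a
field. -/
theorem IsPrimitiveTorsion.exists_eq_aeval (hP : Prime P) (hl : IsPrimitiveTorsion P l) {μ : K}
    (hμ : μ ∈ torsion K P) (hμ0 : μ ≠ 0) : ∃ b : F[X], l = aeval μ (poly b) := by
  obtain ⟨a, rfl⟩ := hl.2 μ hμ
  have hPa : ¬ P ∣ a := by
    rintro ⟨c, rfl⟩
    exact hμ0 (by rw [mul_comm, aeval_poly_mul_eq_zero hl.1])
  obtain ⟨u, v, huv⟩ := (hP.irreducible.coprime_iff_not_dvd).2 hPa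
  refine ⟨v, ?_⟩
  have h := aeval_X (R := F[X]) l
  rw [← poly_one, ← huv, poly_add, map_add, aeval_poly_mul_eq_zero hl.1, zero_add,
    aeval_poly_mul] at h
  exact h.symm

/-- Nonzero elements of `Λ_P` are multiples of each other in the integral closure of `F[X]`. -/
theorem IsPrimitiveTorsion.exists_unit_mul (hPm : P.Monic) (hP : Prime P)
    (O : Type*) [CommRing O] [IsDomain O] [Algebra O K] [Algebra F[X] O] [IsScalarTower F[X] O K]
    [IsIntegralClosure O F[X] K]
    (hl : IsPrimitiveTorsion P l) {μ : K} (hμ : μ ∈ torsion K P) (hμ0 : μ ≠ 0) :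
    ∃ u : Oˣ, μ = algebraMap O K u * l := by
  have hint : ∀ ν ∈ torsion K P, ∃ x : O, algebraMap O K x = ν := fun ν hν =>
    IsIntegralClosure.isIntegral_iff.1 ⟨poly P, monic_poly hPm, by rwa [← aeval_def]⟩
  obtain ⟨m, rfl⟩ := hint μ hμ
  obtain ⟨x, rfl⟩ := hint l hl.1
  have hinj := IsIntegralClosure.algebraMap_injective O F[X] K
  obtain ⟨a, ha⟩ := hl.2 _ hμ
  obtain ⟨b, hb⟩ := hl.exists_eq_aeval hP hμ hμ0
  rw [aeval_algebraMap_apply] at ha hb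
  have h1 : x ∣ m := hinj ha ▸ dvd_aeval_poly a x
  have h2 : m ∣ x := by
    conv_rhs => rw [hinj hb]
    exact dvd_aeval_poly b m
  obtain ⟨u, hu⟩ := associated_of_dvd_dvd h1 h2
  exact ⟨u, by rw [← hu, map_mul, mul_comm]⟩

end field

section splittingField

variable {F : Type*} [Field F] [Fintype F] {K : Type*} [Field K] [Algebra F[X] K]
  [Algebra (RatFunc F) K] [IsScalarTower F[X] (RatFunc F) K] {P : F[X]} {l : K}

theorem separable_map_poly (hP : P ≠ 0) :
    ((poly P).map (algebraMap F[X] (RatFunc F))).Separable := by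
  have h : algebraMap F[X] (RatFunc F) P ≠ 0 := by simpa using hP
  rw [separable_def, derivative_map, derivative_poly, map_C]
  exact (isCoprime_one_right.of_isCoprime_of_dvd_right
    (isUnit_iff_dvd_one.1 (isUnit_C.2 (isUnit_iff_ne_zero.2 h))))

variable (K) in
omit [Fintype F] in
theorem algebraMap_ne_zero (hP : P ≠ 0) : algebraMap F[X] K P ≠ 0 := fun h =>
  hP (FunctionField.algebraMap_injective F K (by rw [h, map_zero]))

theorem ne_zero_of_aeval_cyclotomicPoly (hP : P ≠ 0) {μ : K}
    (h : aeval μ (cyclotomicPoly P) = 0) : μ ≠ 0 := by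
  rintro rfl
  rw [← coeff_zero_eq_aeval_zero', coeff_zero_cyclotomicPoly] at h
  exact algebraMap_ne_zero K hP h

omit [Fintype F] in
theorem aeval_mem_adjoin (l : K) (f : F[X][X]) : aeval l f ∈ Algebra.adjoin (RatFunc F) {l} := by
  rw [← aeval_map_algebraMap (RatFunc F)]
  exact aeval_mem_adjoin_singleton _ _

variable [IsSplittingField (RatFunc F) K ((poly P).map (algebraMap F[X] (RatFunc F)))]

theorem splits_map_cyclotomicPoly (hP : P.Monic) :
    ((cyclotomicPoly P).map (algebraMap F[X] K)).Splits := by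
  have h := IsSplittingField.splits K ((poly P).map (algebraMap F[X] (RatFunc F)))
  rw [map_map, ← IsScalarTower.algebraMap_eq] at h
  refine h.of_dvd ((monic_poly hP).map _).ne_zero (Polynomial.map_dvd _ ?_)
  exact ⟨X, by rw [mul_comm, X_mul_cyclotomicPoly]⟩

theorem IsPrimitiveTorsion.ne_zero (hPm : P.Monic) (hP : Prime P) (hl : IsPrimitiveTorsion P l) :
    l ≠ 0 := by
  rintro rfl
  have hq : 1 < Fintype.card F ^ P.natDegree :=
    Nat.one_lt_pow hP.irreducible.natDegree_pos.ne' Fintype.one_lt_card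
  have hd : ((cyclotomicPoly P).map (algebraMap F[X] K)).degree ≠ 0 := by
    apply degree_ne_of_natDegree_ne
    rw [(monic_cyclotomicPoly hPm).natDegree_map, natDegree_cyclotomicPoly hPm]
    exact (Nat.sub_pos_of_lt hq).ne'
  obtain ⟨μ, hμ⟩ := (splits_map_cyclotomicPoly (K := K) hPm).exists_eval_eq_zero hd
  rw [eval_map_algebraMap] at hμ
  obtain ⟨a, ha⟩ := hl.2 μ (aeval_poly_eq_zero_of_cyclotomicPoly hμ)
  rw [aeval_zero_poly] at ha
  exact ne_zero_of_aeval_cyclotomicPoly hP.ne_zero hμ ha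

theorem IsPrimitiveTorsion.aeval_cyclotomicPoly (hPm : P.Monic) (hP : Prime P)
    (hl : IsPrimitiveTorsion P l) : aeval l (cyclotomicPoly P) = 0 := by
  have h : aeval l (poly P) = 0 := hl.1
  rw [← X_mul_cyclotomicPoly, map_mul, aeval_X] at h
  exact (mul_eq_zero.1 h).resolve_left (hl.ne_zero hPm hP)

theorem IsPrimitiveTorsion.adjoin_eq_top (hl : IsPrimitiveTorsion P l) :
    Algebra.adjoin (RatFunc F) {l} = ⊤ := by
  rw [eq_top_iff,
    ← IsSplittingField.adjoin_rootSet K ((poly P).map (algebraMap F[X] (RatFunc F))),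
    Algebra.adjoin_le_iff]
  intro μ hμ
  have h := aeval_eq_zero_of_mem_rootSet hμ
  rw [aeval_map_algebraMap] at h
  obtain ⟨a, rfl⟩ := hl.2 μ h
  exact aeval_mem_adjoin l _

variable (O : Type*) [CommRing O] [IsDomain O] [Algebra O K] [Algebra F[X] O]
  [IsScalarTower F[X] O K] [IsIntegralClosure O F[X] K]

/-- `P` is totally ramified: it is a unit times the `(q ^ deg P - 1)`-st power of a generator of
`Λ_P`. -/
theorem IsPrimitiveTorsion.associated_pow (hPm : P.Monic) (hP : Prime P) {x : O}
    (hl : IsPrimitiveTorsion P (algebraMap O K x)) :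
    Associated (algebraMap F[X] O P) (x ^ (Fintype.card F ^ P.natDegree - 1)) := by
  -- The ratio of two roots is a unit of `O`, hence so is that of their product and `x ^ n`.
  have key : ∀ s : Multiset K, (∀ μ ∈ s, ∃ u : Oˣ, μ = algebraMap O K u * algebraMap O K x) →
      ∃ u : Oˣ, s.prod = algebraMap O K (u * x ^ Multiset.card s) := by
    intro s
    induction s using Multiset.induction_on with
    | empty => exact fun _ => ⟨1, by simp⟩
    | cons μ s ih =>
      intro h
      obtain ⟨u, hu⟩ := h μ (Multiset.mem_cons_self _ _)
      obtain ⟨v, hv⟩ := ih fun ν hν => h ν (Multiset.mem_cons_of_mem hν)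
      refine ⟨u * v, ?_⟩
      simp only [Multiset.prod_cons, hu, hv, Multiset.card_cons, Units.val_mul, map_mul, map_pow]
      ring
  have hs := splits_map_cyclotomicPoly (K := K) hPm
  have hm := (monic_cyclotomicPoly hPm).map (algebraMap F[X] K)
  obtain ⟨u, hu⟩ := key ((cyclotomicPoly P).map (algebraMap F[X] K)).roots (by
    intro μ hμ
    have h := (mem_roots'.1 hμ).2
    rw [IsRoot, eval_map_algebraMap] at h
    exact hl.exists_unit_mul hPm hP O (aeval_poly_eq_zero_of_cyclotomicPoly h)
      (ne_zero_of_aeval_cyclotomicPoly hP.ne_zero h))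
  have h0 := hs.coeff_zero_eq_prod_roots_of_monic hm
  rw [hu, ← hs.natDegree_eq_card_roots, coeff_map, coeff_zero_cyclotomicPoly,
    (monic_cyclotomicPoly hPm).natDegree_map, natDegree_cyclotomicPoly hPm] at h0
  refine Associated.symm ⟨(-1) ^ (Fintype.card F ^ P.natDegree - 1) * u, ?_⟩
  apply IsIntegralClosure.algebraMap_injective O F[X] K
  rw [← IsScalarTower.algebraMap_apply, h0]
  simp only [Units.val_mul, Units.val_pow_eq_pow_val, Units.val_neg, Units.val_one, map_mul,
    map_pow, map_neg, map_one]
  ring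

end splittingField

/-! ### The Galois group and the norm of `1 - λ` -/

section galois

variable {F : Type*} [Field F] [Fintype F] {K : Type*} [Field K] [Algebra F[X] K]
  [Algebra (RatFunc F) K] [IsScalarTower F[X] (RatFunc F) K] {P : F[X]} {l : K}
  [IsSplittingField (RatFunc F) K ((poly P).map (algebraMap F[X] (RatFunc F)))]

variable (K) in
omit [Algebra F[X] K] [IsScalarTower F[X] (RatFunc F) K] in
theorem isGalois_of_isSplittingField (hP : P ≠ 0) : IsGalois (RatFunc F) K :=
  IsGalois.of_separable_splitting_field (separable_map_poly hP)

theorem algEquiv_ext (hl : IsPrimitiveTorsion P l) {σ τ : Gal(K/RatFunc F)} (h : σ l = τ l) :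
    σ = τ := by
  have h1 := AlgHom.ext_of_adjoin_eq_top (φ₁ := (σ : K →ₐ[RatFunc F] K))
    (φ₂ := (τ : K →ₐ[RatFunc F] K)) hl.adjoin_eq_top (by simpa using h)
  exact AlgEquiv.ext fun y => DFunLike.congr_fun h1 y

/-- The degree of `K_P` over `k`. It is at most `n = q ^ deg P - 1` because `K_P` is generated by a
root of `C_P(x) / x`, and it is divisible by `n` because `P` is an `n`-th power up to a unit, so
that its norm `P ^ [K_P : k]` is one too. -/
theorem finrank_eq (hPm : P.Monic) (hP : Prime P) (hl : IsPrimitiveTorsion P l) :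
    Module.finrank (RatFunc F) K = Fintype.card F ^ P.natDegree - 1 := by
  have : FiniteDimensional (RatFunc F) K :=
    IsSplittingField.finiteDimensional K ((poly P).map (algebraMap F[X] (RatFunc F)))
  have := isGalois_of_isSplittingField K hP.ne_zero
  have hpos : 0 < Module.finrank (RatFunc F) K := Module.finrank_pos
  set n := Fintype.card F ^ P.natDegree - 1 with hn
  have hn0 : n ≠ 0 := (Nat.sub_pos_of_lt
    (Nat.one_lt_pow hP.irreducible.natDegree_pos.ne' Fintype.one_lt_card)).ne'
  have hQ := (monic_cyclotomicPoly hPm).map (algebraMap F[X] (RatFunc F))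
  apply le_antisymm
  · rw [(PowerBasis.ofAdjoinEqTop (Algebra.IsIntegral.isIntegral l) hl.adjoin_eq_top).finrank,
      PowerBasis.ofAdjoinEqTop_dim, hn, ← natDegree_cyclotomicPoly hPm,
      ← (monic_cyclotomicPoly hPm).natDegree_map (algebraMap F[X] (RatFunc F))]
    refine natDegree_le_of_dvd (minpoly.dvd _ _ ?_) hQ.ne_zero
    rw [aeval_map_algebraMap, hl.aeval_cyclotomicPoly hPm hP]
  · let O := FunctionField.ringOfIntegers F K
    have : Module.IsTorsionFree F[X] O :=
      Module.isTorsionFree_iff_algebraMap_injective.2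
        (FunctionField.ringOfIntegers.algebraMap_injective F K)
    have : Algebra.IsIntegral F[X] O := IsIntegralClosure.isIntegral_algebra F[X] K
    obtain ⟨x, rfl⟩ : ∃ x : O, algebraMap O K x = l :=
      IsIntegralClosure.isIntegral_iff.1 ⟨poly P, monic_poly hPm, by rw [← aeval_def]; exact hl.1⟩
    have h1 := (hl.associated_pow O hPm hP).map (Algebra.intNorm F[X] O)
    have h2 : Algebra.intNorm F[X] O (algebraMap F[X] O P) =
        P ^ Module.finrank (RatFunc F) K := by
      apply IsFractionRing.injective F[X] (RatFunc F)
      rw [Algebra.algebraMap_intNorm (L := K), ← IsScalarTower.algebraMap_apply,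
        IsScalarTower.algebraMap_apply F[X] (RatFunc F) K, Algebra.norm_algebraMap, map_pow]
    rw [h2, map_pow] at h1
    -- The norm of `x` divides a power of `P`, so it is associated to some `P ^ j`.
    obtain ⟨j, -, hj⟩ := (dvd_prime_pow hP _).1 ((dvd_pow_self _ hn0).trans h1.symm.dvd)
    have h3 := h1.trans (hj.pow_pow (n := n))
    rw [← pow_mul] at h3
    -- Comparing exponents of `P`; `j ≠ 0` because the degree is positive.
    have h4 : Module.finrank (RatFunc F) K = j * n := le_antisymm
      ((pow_dvd_pow_iff hP.ne_zero hP.not_isUnit).1 h3.dvd)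
      ((pow_dvd_pow_iff hP.ne_zero hP.not_isUnit).1 h3.symm.dvd)
    rw [h4] at hpos ⊢
    exact Nat.le_mul_of_pos_left _ (Nat.pos_of_mul_pos_right hpos)

/-- The conjugates of `l` are distinct roots of `C_P(x) / x`, and there are as many of them as its
degree. -/
theorem prod_X_sub_C_eq [FiniteDimensional (RatFunc F) K] (hPm : P.Monic) (hP : Prime P)
    (hl : IsPrimitiveTorsion P l) :
    ∏ σ : Gal(K/RatFunc F), (X - C (σ l)) = (cyclotomicPoly P).map (algebraMap F[X] K) := by
  have := isGalois_of_isSplittingField K hP.ne_zero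
  symm
  apply eq_of_monic_of_dvd_of_natDegree_le (monic_prod_X_sub_C _ _)
    ((monic_cyclotomicPoly hPm).map _)
  · refine Fintype.prod_dvd_of_coprime (pairwise_coprime_X_sub_C fun σ τ h => algEquiv_ext hl h)
      fun σ => ?_
    rw [dvd_iff_isRoot, IsRoot, eval_map_algebraMap]
    have h := aeval_algHom_apply ((σ : K →ₐ[RatFunc F] K).restrictScalars F[X]) l (cyclotomicPoly P)
    rw [hl.aeval_cyclotomicPoly hPm hP, map_zero] at h
    exact h
  · rw [natDegree_finsetProd_X_sub_C_eq_card, (monic_cyclotomicPoly hPm).natDegree_map,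
      natDegree_cyclotomicPoly hPm, ← finrank_eq hPm hP hl, ← IsGalois.card_aut_eq_finrank,
      Finset.card_univ, Nat.card_eq_fintype_card]

/-- The norm of `1 - λ` for a generator `λ` of `Λ_P`. -/
theorem prod_one_sub [FiniteDimensional (RatFunc F) K] (hPm : P.Monic) (hP : Prime P)
    (hl : IsPrimitiveTorsion P l) :
    ∏ σ : Gal(K/RatFunc F), σ (1 - l) = algebraMap F[X] K ((poly P).eval 1) := by
  have h := congrArg (eval 1) (prod_X_sub_C_eq hPm hP hl)
  rw [eval_prod, eval_one_map, eval_one_cyclotomicPoly] at h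
  simpa using h

end galois

section coprime

variable {F : Type*} [Field F] [Fintype F] {K : Type*} [Field K] [Algebra F[X] K] {P : F[X]}
  {O : Type*} [CommRing O] [Algebra O K] [Algebra F[X] O] [IsScalarTower F[X] O K]
  [IsIntegralClosure O F[X] K]

/-- Distinct conjugates of `1 - x` are coprime, where `x` generates `Λ_P`: two conjugates of `x`
are related by `τ x = C_c(σ x)`, so modulo `1 - σ x` and `1 - τ x` the element `1` is killed both by
`C_{c - 1}` and by `C_P`, while `c - 1` is prime to `P` as `σ x ≠ τ x`. -/
theorem isCoprime_one_sub (hP : Prime P) {x : O} (hx : IsPrimitiveTorsion P (algebraMap O K x))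
    {σ τ : O ≃ₐ[F[X]] O} (h : σ x ≠ τ x) : IsCoprime (1 - σ x) (1 - τ x) := by
  have hinj := IsIntegralClosure.algebraMap_injective O F[X] K
  have hx0 : aeval x (poly P) = 0 := hinj (by
    rw [← aeval_algebraMap_apply, map_zero]
    exact hx.1)
  have hconj : ∀ ρ : O ≃ₐ[F[X]] O, aeval (ρ x) (poly P) = 0 := fun ρ => by
    rw [aeval_algHom_apply, hx0, map_zero]
  -- `σ⁻¹ (τ x)` lies in `Λ_P`, so it is `C_c(x)` for some `c`.
  obtain ⟨c, hc⟩ : ∃ c : F[X], τ x = aeval (σ x) (poly c) := by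
    obtain ⟨c, hc⟩ := hx.2 (algebraMap O K ((τ.trans σ.symm) x)) (by
      rw [torsion, Set.mem_ofPred_eq, aeval_algebraMap_apply, hconj, map_zero])
    rw [aeval_algebraMap_apply] at hc
    refine ⟨c, ?_⟩
    rw [aeval_algHom_apply, ← hinj hc, AlgEquiv.trans_apply, AlgEquiv.apply_symm_apply]
  have hPc : ¬ P ∣ c - 1 := by
    rintro ⟨e, he⟩
    rw [sub_eq_iff_eq_add.1 he, poly_add, map_add, mul_comm, aeval_poly_mul_eq_zero (hconj σ),
      poly_one, aeval_X, zero_add] at hc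
    exact h hc.symm
  let I : Ideal O := Ideal.span {1 - σ x, 1 - τ x}
  have hσ : algebraMap O (O ⧸ I) (σ x) = 1 := by
    symm
    rw [← sub_eq_zero, ← map_one (algebraMap O (O ⧸ I)), ← map_sub]
    exact Ideal.Quotient.eq_zero_iff_mem.2 (Ideal.subset_span (by simp))
  have hτ : algebraMap O (O ⧸ I) (τ x) = 1 := by
    symm
    rw [← sub_eq_zero, ← map_one (algebraMap O (O ⧸ I)), ← map_sub]
    exact Ideal.Quotient.eq_zero_iff_mem.2 (Ideal.subset_span (by simp))
  have h1 : aeval (1 : O ⧸ I) (poly P) = 0 := by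
    rw [← hσ, aeval_algebraMap_apply, hconj, map_zero]
  have h2 : aeval (1 : O ⧸ I) (poly (c - 1)) = 0 := by
    rw [sub_eq_add_neg, poly_add, poly_neg, poly_one, map_add, map_neg, aeval_X, ← hσ,
      aeval_algebraMap_apply, ← hc, hτ, hσ, add_neg_cancel]
  have h3 : (1 : O ⧸ I) = 0 :=
    eq_zero_of_aeval_poly_eq_zero ((hP.irreducible.coprime_iff_not_dvd).2 hPc) h1 h2
  have h4 : (1 : O) ∈ I := Ideal.Quotient.eq_zero_iff_mem.1 h3
  obtain ⟨u, v, huv⟩ := Ideal.mem_span_pair.1 h4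
  exact ⟨u, v, huv⟩

end coprime

/-! ### Primality of the norm and of `1 - λ` -/

/-- In an integral extension of an integrally closed domain, divisibility between elements of the
base can be tested upstairs. -/
theorem dvd_of_algebraMap_dvd {A O : Type*} (k K : Type*) [CommRing A] [IsDomain A]
    [IsIntegrallyClosed A] [Field k] [Algebra A k] [IsFractionRing A k] [Field K] [Algebra A K]
    [Algebra k K] [IsScalarTower A k K] [CommRing O] [Algebra A O] [Algebra O K]
    [IsScalarTower A O K] [Algebra.IsIntegral A O] {m a : A}
    (h : algebraMap A O m ∣ algebraMap A O a) : m ∣ a := by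
  have hinj : Function.Injective (algebraMap A K) := by
    rw [IsScalarTower.algebraMap_eq A k K]
    exact (algebraMap k K).injective.comp (IsFractionRing.injective A k)
  obtain ⟨z, hz⟩ := h
  have hz' : algebraMap A K a = algebraMap A K m * algebraMap O K z := by
    rw [IsScalarTower.algebraMap_apply A O K, hz, map_mul, ← IsScalarTower.algebraMap_apply]
  rcases eq_or_ne m 0 with rfl | hm
  · rw [map_zero, zero_mul, ← map_zero (algebraMap A K)] at hz'
    exact (hinj hz').symm ▸ dvd_rfl
  have hmK : algebraMap A K m ≠ 0 := (map_ne_zero_iff _ hinj).2 hm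
  have ht : algebraMap k K (algebraMap A k a / algebraMap A k m) = algebraMap O K z := by
    rw [map_div₀, ← IsScalarTower.algebraMap_apply, ← IsScalarTower.algebraMap_apply, hz',
      mul_div_cancel_left₀ _ hmK]
  have hint : IsIntegral A (algebraMap A k a / algebraMap A k m) := by
    rw [← isIntegral_algebraMap_iff (algebraMap k K).injective, ht]
    exact (Algebra.IsIntegral.isIntegral z).algebraMap
  obtain ⟨r, hr⟩ := IsIntegrallyClosed.isIntegral_iff.1 hint
  refine ⟨r, hinj ?_⟩
  rw [map_mul, IsScalarTower.algebraMap_apply A k K r, hr, ht, hz']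

/-- An ideal whose relative norm is prime is itself prime: a factorization of the ideal gives one of
its norm, and only the unit ideal has unit norm. -/
theorem prime_of_prime_relNorm {R S : Type*} [CommRing R] [IsDedekindDomain R] [CommRing S]
    [IsDedekindDomain S] [Algebra R S] [Module.Finite R S] [Module.IsTorsionFree R S] {I : Ideal S}
    (h : Prime (Ideal.relNorm R I)) : Prime I := by
  have hunit : ∀ J : Ideal S, IsUnit (Ideal.relNorm R J) → IsUnit J := by
    intro J hJ
    rw [Ideal.isUnit_iff] at hJ ⊢
    have hle := Ideal.relNorm_le_comap R J
    rwa [hJ, top_le_iff, Ideal.comap_eq_top_iff] at hle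
  refine Irreducible.prime ⟨fun hI => h.not_isUnit (hI.map _), fun J J' hJ => ?_⟩
  rw [hJ, map_mul] at h
  exact (h.irreducible.isUnit_or_isUnit rfl).imp (hunit J) (hunit J')

section main

variable {F : Type*} [Field F] [Fintype F] {K : Type*} [Field K] [Algebra F[X] K]
  [Algebra (RatFunc F) K] [IsScalarTower F[X] (RatFunc F) K] {P : F[X]}
  [IsSplittingField (RatFunc F) K ((poly P).map (algebraMap F[X] (RatFunc F)))]
  {O : Type*} [CommRing O] [Algebra O K] [Algebra F[X] O]
  [IsScalarTower F[X] O K] [IsIntegralClosure O F[X] K] {x : O}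

theorem prod_galRestrict_one_sub [FiniteDimensional (RatFunc F) K] (hPm : P.Monic) (hP : Prime P)
    (hx : IsPrimitiveTorsion P (algebraMap O K x)) :
    ∏ σ : Gal(K/RatFunc F), (1 - galRestrict F[X] (RatFunc F) K O σ x) =
      algebraMap F[X] O ((poly P).eval 1) := by
  apply IsIntegralClosure.algebraMap_injective O F[X] K
  simpa [algebraMap_galRestrict_apply, ← IsScalarTower.algebraMap_apply] using
    prod_one_sub hPm hP hx

theorem isCoprime_galRestrict_one_sub [FiniteDimensional (RatFunc F) K] (hP : Prime P)
    (hx : IsPrimitiveTorsion P (algebraMap O K x)) {σ τ : Gal(K/RatFunc F)} (h : σ ≠ τ) :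
    IsCoprime (1 - galRestrict F[X] (RatFunc F) K O σ x)
      (1 - galRestrict F[X] (RatFunc F) K O τ x) := by
  refine isCoprime_one_sub hP hx fun he => h (algEquiv_ext hx ?_)
  simpa [algebraMap_galRestrict_apply] using congrArg (algebraMap O K) he

omit [Fintype F] in
theorem prime_galRestrict_one_sub [FiniteDimensional (RatFunc F) K] (hπ : Prime (1 - x))
    (σ : Gal(K/RatFunc F)) : Prime (1 - galRestrict F[X] (RatFunc F) K O σ x) := by
  simpa using (MulEquiv.prime_iff (galRestrict F[X] (RatFunc F) K O σ)).2 hπ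

variable [IsDomain O]

/-- If `1 - λ` is prime, then so is its norm `C_P(1)`: whenever `1 - λ` divides an element of
`F[X]`, so do all its pairwise coprime conjugates, hence so does their product. -/
theorem prime_eval_of_prime_one_sub [FiniteDimensional (RatFunc F) K] (hPm : P.Monic)
    (hP : Prime P) (hx : IsPrimitiveTorsion P (algebraMap O K x)) (hπ : Prime (1 - x)) :
    Prime ((poly P).eval 1) := by
  have : Algebra.IsIntegral F[X] O := IsIntegralClosure.isIntegral_algebra F[X] K
  have hprod := prod_galRestrict_one_sub hPm hP hx
  have hdvd : 1 - x ∣ algebraMap F[X] O ((poly P).eval 1) := by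
    rw [← hprod]
    simpa using Finset.dvd_prod_of_mem
      (fun σ : Gal(K/RatFunc F) => 1 - galRestrict F[X] (RatFunc F) K O σ x)
      (Finset.mem_univ 1)
  have key : ∀ a : F[X], 1 - x ∣ algebraMap F[X] O a → (poly P).eval 1 ∣ a := by
    intro a ha
    apply dvd_of_algebraMap_dvd (O := O) (RatFunc F) K
    rw [← hprod]
    refine Fintype.prod_dvd_of_coprime (fun σ τ h => isCoprime_galRestrict_one_sub hP hx h)
      fun σ => ?_
    simpa using map_dvd (galRestrict F[X] (RatFunc F) K O σ) ha
  refine ⟨fun h0 => ?_, fun hu => hπ.not_isUnit (isUnit_of_dvd_unit hdvd (hu.map _)),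
    fun a b hab => ?_⟩
  · rw [h0, map_zero, Finset.prod_eq_zero_iff] at hprod
    obtain ⟨σ, -, hσ⟩ := hprod
    exact (prime_galRestrict_one_sub (K := K) hπ σ).ne_zero hσ
  · have h := hdvd.trans (map_dvd (algebraMap F[X] O) hab)
    rw [map_mul] at h
    exact (hπ.dvd_or_dvd h).imp (key a) (key b)

/-- The ideal `(1 - λ)` has relative norm `(C_P(1))`, so it is prime if `C_P(1)` is. -/
theorem prime_one_sub_of_prime_eval [FiniteDimensional (RatFunc F) K] (hPm : P.Monic)
    (hP : Prime P) (hx : IsPrimitiveTorsion P (algebraMap O K x))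
    (hM : Prime ((poly P).eval 1)) : Prime (1 - x) := by
  have := isGalois_of_isSplittingField K hP.ne_zero
  have : IsDedekindDomain O := IsIntegralClosure.isDedekindDomain F[X] (RatFunc F) K O
  have : Module.Finite F[X] O := IsIntegralClosure.finite F[X] (RatFunc F) K O
  have : Module.IsTorsionFree F[X] O := by
    apply Module.isTorsionFree_iff_algebraMap_injective.2
    have h := FunctionField.algebraMap_injective F K
    rw [IsScalarTower.algebraMap_eq F[X] O K, RingHom.coe_comp] at h
    exact h.of_comp
  have hnorm : Algebra.intNorm F[X] O (1 - x) = (poly P).eval 1 := by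
    apply FunctionField.algebraMap_injective F K
    rw [IsScalarTower.algebraMap_apply F[X] (RatFunc F) K, Algebra.algebraMap_intNorm (L := K),
      Algebra.norm_eq_prod_automorphisms, ← prod_one_sub hPm hP hx, map_sub, map_one]
  have hI : Prime (Ideal.span {1 - x}) := by
    apply prime_of_prime_relNorm (R := F[X])
    rwa [Ideal.relNorm_singleton, hnorm, Ideal.prime_span_singleton_iff]
  exact Ideal.prime_span_singleton_iff.1 hI

theorem prime_eval_iff_prime_one_sub [FiniteDimensional (RatFunc F) K] (hPm : P.Monic)
    (hP : Prime P) (hx : IsPrimitiveTorsion P (algebraMap O K x)) :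
    Prime ((poly P).eval 1) ↔ Prime (1 - x) :=
  ⟨prime_one_sub_of_prime_eval hPm hP hx, prime_eval_of_prime_one_sub hPm hP hx⟩

end main

/-- The prime ideals above `C_P(1)` are those generated by the conjugates of `1 - λ`. -/
theorem splitsCompletely_eval {F : Type*} [Field F] [Fintype F] {K : Type*} [Field K]
    [Algebra F[X] K] [Algebra (RatFunc F) K] [IsScalarTower F[X] (RatFunc F) K] {P : F[X]}
    [IsSplittingField (RatFunc F) K ((poly P).map (algebraMap F[X] (RatFunc F)))]
    [FiniteDimensional (RatFunc F) K] (hPm : P.Monic) (hP : Prime P)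
    {x : FunctionField.ringOfIntegers F K} (hx : IsPrimitiveTorsion P (x : K))
    (hM : Prime ((poly P).eval 1)) : SplitsCompletely K ((poly P).eval 1) := by
  classical
  have := isGalois_of_isSplittingField K hP.ne_zero
  let O := FunctionField.ringOfIntegers F K
  have hx' : IsPrimitiveTorsion P (algebraMap O K x) := hx
  have hπ := prime_galRestrict_one_sub (F := F) (K := K) (prime_one_sub_of_prime_eval hPm hP hx' hM)
  let 𝔮 : Gal(K/RatFunc F) → Ideal O := fun σ =>
    Ideal.span {1 - galRestrict F[X] (RatFunc F) K O σ x}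
  have h𝔮 : Function.Injective 𝔮 := by
    intro σ τ h
    by_contra hne
    exact (hπ σ).not_isUnit ((isCoprime_galRestrict_one_sub hP hx' hne).isUnit_of_dvd' dvd_rfl
      (Ideal.span_singleton_le_span_singleton.1 h.symm.le))
  refine ⟨Finset.univ.image 𝔮, ?_, ?_, ?_⟩
  · intro I hI
    obtain ⟨σ, -, rfl⟩ := Finset.mem_image.1 hI
    exact ⟨(Ideal.span_singleton_prime (hπ σ).ne_zero).2 (hπ σ),
      fun h => (hπ σ).ne_zero (Ideal.span_singleton_eq_bot.1 h)⟩
  · rw [Finset.card_image_of_injective _ h𝔮, ← IsGalois.card_aut_eq_finrank, Finset.card_univ,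
      Nat.card_eq_fintype_card]
  · rw [Finset.prod_image h𝔮.injOn, Ideal.prod_span_singleton]
    exact congrArg (fun y => Ideal.span {y}) (prod_galRestrict_one_sub hPm hP hx').symm

end Carlitz

theorem theorem5p1 {F : Type*} [Field F] [Fintype F]
    {kbar : Type*} [Field kbar] [Algebra (RatFunc F) kbar] [IsAlgClosure (RatFunc F) kbar]
    [Algebra F[X] kbar] [IsScalarTower F[X] (RatFunc F) kbar]
    (P : F[X]) (hPmonic : P.Monic) (hPprime : Prime P)
    (l : kbar) (hl : Carlitz.IsPrimitiveTorsion P l)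
    (α : Fˣ) (M : F[X]) (hM : M = C (α : F) * (Carlitz.poly P).eval 1) :
    (Prime M ↔
      ∃ π : FunctionField.ringOfIntegers F (Carlitz.cyclotomicField kbar P),
        ((π : Carlitz.cyclotomicField kbar P) : kbar) = 1 - l ∧ Prime π) ∧
    (Prime M → Carlitz.SplitsCompletely (Carlitz.cyclotomicField kbar P) M) := by
  let K := Carlitz.cyclotomicField kbar P
  let O := FunctionField.ringOfIntegers F K
  have : IsAlgClosed kbar := IsAlgClosure.isAlgClosed (RatFunc F)
  -- `K_P` is the splitting field of `C_P` over `k`.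
  have hroot : Carlitz.torsion kbar P =
      ((Carlitz.poly P).map (algebraMap F[X] (RatFunc F))).rootSet kbar := by
    ext μ
    rw [mem_rootSet_of_ne ((Carlitz.monic_poly hPmonic).map _).ne_zero, aeval_map_algebraMap]
    rfl
  have hK : IsSplittingField (RatFunc F) K
      ((Carlitz.poly P).map (algebraMap F[X] (RatFunc F))) :=
    IntermediateField.isSplittingField_iff.2
      ⟨IntermediateField.splits_of_splits (L := kbar) (IsAlgClosed.splits _)
        fun μ hμ => IntermediateField.subset_adjoin _ _ (hroot ▸ hμ), by rw [← hroot]⟩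
  have : FiniteDimensional (RatFunc F) K := IsSplittingField.finiteDimensional K
    ((Carlitz.poly P).map (algebraMap F[X] (RatFunc F)))
  have : IsScalarTower F[X] K kbar := IsScalarTower.of_algebraMap_eq fun a => by
    rw [IsScalarTower.algebraMap_apply F[X] (RatFunc F) K,
      ← IsScalarTower.algebraMap_apply (RatFunc F) K kbar, ← IsScalarTower.algebraMap_apply]
  have hcoe : ∀ (y : K) (a : F[X]), aeval (y : kbar) (Carlitz.poly a) =
      (aeval y (Carlitz.poly a) : K) := fun y a => aeval_algebraMap_apply kbar y (Carlitz.poly a)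
  have hmem : ∀ μ ∈ Carlitz.torsion kbar P, μ ∈ K := fun μ hμ =>
    IntermediateField.subset_adjoin _ _ hμ
  have hlK : Carlitz.IsPrimitiveTorsion P (⟨l, hmem l hl.1⟩ : K) := by
    refine ⟨Subtype.ext ((hcoe _ P).symm.trans hl.1), fun μ hμ => ?_⟩
    obtain ⟨a, ha⟩ := hl.2 μ ((hcoe μ P).trans (congrArg Subtype.val hμ))
    exact ⟨a, Subtype.ext (ha.trans (hcoe ⟨l, hmem l hl.1⟩ a))⟩
  obtain ⟨x, hx⟩ : ∃ x : O, algebraMap O K x = ⟨l, hmem l hl.1⟩ :=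
    IsIntegralClosure.isIntegral_iff.1
      ⟨Carlitz.poly P, Carlitz.monic_poly hPmonic, by rw [← aeval_def]; exact hlK.1⟩
  rw [← hx] at hlK
  have hxl : ((x : K) : kbar) = l := congrArg Subtype.val hx
  have hassoc : Associated ((Carlitz.poly P).eval 1) M := by
    rw [hM, mul_comm]
    exact associated_mul_unit_right _ _ (isUnit_C.2 α.isUnit)
  refine ⟨?_, fun hMp => ?_⟩
  · rw [← hassoc.prime_iff, Carlitz.prime_eval_iff_prime_one_sub hPmonic hPprime hlK]
    constructor
    · exact fun h => ⟨1 - x, by simp [hxl], h⟩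
    · rintro ⟨π, hπ, hprime⟩
      have : π = 1 - x := by
        apply Subtype.ext
        apply Subtype.ext
        rw [hπ, ← hxl]
        rfl
      rwa [← this]
  · obtain ⟨s, h1, h2, h3⟩ := Carlitz.splitsCompletely_eval hPmonic hPprime hlK
      (hassoc.prime_iff.2 hMp)
    refine ⟨s, h1, h2, ?_⟩
    rw [← h3, Ideal.span_singleton_eq_span_singleton]
    exact (hassoc.map (algebraMap F[X] O)).symm
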